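/- Let $q$ be a prime power, let $0\le u_1,u_2<k$ be integers with $(q,k,u_1,u_2)\neq(2,2,1,1)$, and let $S_{u_1},S_{u_2}\subseteq\mathbb F_q^k$ be subspaces of dimensions $u_1$ and $u_2$ with $S_{u_1}\cap S_{u_2}=\{0\}$. Let $C$ be the linear code over $\mathbb F_q$ spanned by the rows of a matrix $G$ whose columns are the vectors of $\mathbb F_q^k\setminus(S_{u_1}\cup S_{u_2})$, each occurring exactly once, in any order. Then $C$ has length $n=q^k-q^{u_1}-q^{u_2}+1$ and dimension $k$. The support weight $\chi(D)$ of a subcode $D\subseteq C$ is the number of coordinates at which some codeword of $D$ is nonzero. Let $A^{(j)}_i$ be the number of $j$-dimensional subcodes $D\subseteq C$ with $\chi(D)=i$, let $d_j(C)$ be the minimum of $\chi(D)$ over all $j$-dimensional subcodes $D\subseteq C$, and call $\{d_j(C): 1\le j\le\dim C\}$ the weight hierarchy of $C$. Let $$\begin{bmatrix}a\\ b\end{bmatrix}=\prod_{i=0}^{b-1}\frac{q^a-q^i}{q^b-q^i}\quad(b\ge0)$$ be the Gaussian coefficient (equal to $1$ for $b=0$, and taken to be $0$ for $b<0$), and put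 $$N(k,m,u_1,u_2,t_1,t_2)=\sum_{t=0}^{\min\{u_1-t_1,\,u_2-t_2\}}q^{(u_1+u_2-t-t_1-t_2)(m-t-t_1-t_2)}\,N_t(u_1,u_2,t_1,t_2)\begin{bmatrix}k-u_1-u_2\\ m-t-t_1-t_2\end{bmatrix},$$ $$N_t(u_1,u_2,t_1,t_2)=\prod_{i=0}^{t-1}(q^t-q^i)\cdot\begin{bmatrix}u_1-t_1\\ t\end{bmatrix}\begin{bmatrix}u_2-t_2\\ t\end{bmatrix}\begin{bmatrix}u_1\\ t_1\end{bmatrix}\begin{bmatrix}u_2\\ t_2\end{bmatrix},$$ with $N(k,m,u_1,u_2,t_1,t_2)=0$ if $t_1>u_1$ or $t_2>u_2$. Then for all $1\le j\le k$ and $0\le i\le n$ the $j$-th support weight distribution is given as follows. If $n-i=q^{k-j}-q^{t_1}-q^{t_2}+1$ for some integers $t_1,t_2$ with $\max\{0,u_r-j\}\le t_r\le u_r$ for $r=1,2$, then $$A^{(j)}_i=\begin{cases}N(k,k-j,u_1,u_2,t_1,t_2)+N(k,k-j,u_1,u_2,t_2,t_1),& t_1\ne t_2,\\ N(k,k-j,u_1,u_2,t_1,t_2),&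 t_1=t_2,\end{cases}$$ and if there are no such $t_1,t_2$, then $A^{(j)}_i=0$. Moreover, $C$ has the weight hierarchy $\{d_1(C),\dots,d_k(C)\}$, where for $1\le j\le k$ $$d_j(C)=q^k-q^{u_1}-q^{u_2}-q^{k-j}+e_1+e_2,\qquad e_r=\begin{cases}q^{u_r-j},& j<u_r,\\ 1,& j\ge u_r\end{cases}\quad(r=1,2).$$ -/

import Mathlib

namespace SolomonStiffler

/-- The columns of `G` are exactly the elements of the set `T`, each occurring once
(in an arbitrary order): `G` is a matrix `[T]`. -/
def IsMatrixOfSet {F : Type*} {k n : ℕ} (G : Matrix (Fin k) (Fin n) F)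
    (T : Set (Fin k → F)) : Prop :=
  Set.BijOn (fun c : Fin n => fun r : Fin k => G r c) Set.univ T

/-- The linear code generated by the rows of `G`. -/
def rowCode {F : Type*} [Field F] {k n : ℕ} (G : Matrix (Fin k) (Fin n) F) :
    Submodule F (Fin n → F) :=
  Submodule.span F (Set.range fun r : Fin k => fun c : Fin n => G r c)

/-- The support weight of a (sub)code: the number of coordinates at which some codeword
is nonzero. -/
noncomputable def supportWeight {F : Type*} [Field F] {n : ℕ}
    (D : Submodule F (Fin n → F)) : ℕ :=
  Set.ncard {c : Fin n | ∃ x ∈ D, x c ≠ 0}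

/-- The number of `r`-dimensional subcodes of `C` with support weight `i`. -/
noncomputable def supportWeightDistr {F : Type*} [Field F] {n : ℕ}
    (C : Submodule F (Fin n → F)) (r i : ℕ) : ℕ :=
  Set.ncard {D : Submodule F (Fin n → F) |
    D ≤ C ∧ Module.finrank F D = r ∧ supportWeight D = i}

/-- The `r`-th minimum support weight (`r`-th generalized Hamming weight) of `C`; the set is
nonempty precisely when `r` is at most the dimension of `C`. -/
noncomputable def minSupportWeight {F : Type*} [Field F] {n : ℕ}
    (C : Submodule F (Fin n → F)) (r : ℕ) : ℕ :=
  sInf {w : ℕ | ∃ D : Submodule F (Fin n → F),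
    D ≤ C ∧ Module.finrank F D = r ∧ supportWeight D = w}

/-- The weight hierarchy: the set of the generalized Hamming weights `d_r(C)`,
`1 ≤ r ≤ dim C`. -/
def weightHierarchy {F : Type*} [Field F] {n : ℕ}
    (C : Submodule F (Fin n → F)) : Set ℕ :=
  {w : ℕ | ∃ r : ℕ, 1 ≤ r ∧ r ≤ Module.finrank F C ∧ minSupportWeight C r = w}

/-- The Gaussian coefficient
`(q^a - 1)(q^a - q)⋯(q^a - q^(b-1)) / ((q^b - 1)(q^b - q)⋯(q^b - q^(b-1)))`,
as a rational number; it is `1` for `b = 0` and `0` for `a < b`. -/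
def gaussCoeff (q a b : ℕ) : ℚ :=
  (∏ i ∈ Finset.range b, ((q : ℚ) ^ a - (q : ℚ) ^ i)) /
    ∏ i ∈ Finset.range b, ((q : ℚ) ^ b - (q : ℚ) ^ i)

/-- `N_t(u₁, u₂, t₁, t₂)`. For `t = 0` the product and the first two Gaussian coefficients
are `1`. -/
def innerCount (q u₁ u₂ t₁ t₂ t : ℕ) : ℚ :=
  (∏ i ∈ Finset.range t, ((q : ℚ) ^ t - (q : ℚ) ^ i)) *
    gaussCoeff q (u₁ - t₁) t * gaussCoeff q (u₂ - t₂) t *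
    gaussCoeff q u₁ t₁ * gaussCoeff q u₂ t₂

/-- `N(k, m, u₁, u₂, t₁, t₂)`, by its explicit formula. The terms with `m < t + t₁ + t₂` vanish,
because a Gaussian coefficient with negative lower index is `0`. If `t₁ > u₁` or `t₂ > u₂`, the
whole sum is `0`, because a factor `gaussCoeff q u₁ t₁` or `gaussCoeff q u₂ t₂` is. -/
def outerCount (q k m u₁ u₂ t₁ t₂ : ℕ) : ℚ :=
  ∑ t ∈ Finset.range (min (u₁ - t₁) (u₂ - t₂) + 1),
    if t + t₁ + t₂ ≤ m then
      (q : ℚ) ^ ((u₁ + u₂ - (t + t₁ + t₂)) * (m - (t + t₁ + t₂))) *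
        innerCount q u₁ u₂ t₁ t₂ t *
        gaussCoeff q (k - u₁ - u₂) (m - (t + t₁ + t₂))
    else 0

end SolomonStiffler

open Module

namespace SolomonStiffler

/-! ### Fibrewise counting and the correspondence theorem. -/

section Counting

/-! Codewords are evaluations of linear functionals at the columns. If evaluation is injective,
annihilators match the j-dimensional subcodes with the subspaces V of dimension k - j, and a
coordinate lies outside the support exactly when its column lies in V (`supportWeight_add_ncard`,
`exists_subcode_iff`). With t_r = dim(V ∩ S_r), inclusion-exclusion gives n - χ = q^(k-j) - q^t₁ -
q^t₂ + 1. This value fixes the unordered pair {t₁, t₂}, so A^(j)_i counts the V with prescribed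
intersection dimensions, in either order.

For that count (`natCard_finrank_comap_subtype`), write the space as K ⊕ S₁ ⊕ S₂ and let W = V ∩ (S₁
⊕ S₂). Modulo its intersections with S₁ and S₂, W is the graph of an injective map on a
t-dimensional subspace, which gives N_t. Modulo W, V is the graph of a linear map from a subspace of
K, which gives the power of q and the last Gaussian coefficient.

Evaluation is injective because no hyperplane contains all columns; this is where (2,2,1,1) must be
excluded. The minimum weight is reached when both t_r take their least value max(0, u_r - j); a
positive summand of N shows that this happens for a single V. -/

theorem natCard_subtype_eq_sum {α : Type*} [Finite α] (p : α → Prop) (f : α → ℕ) (s : Finset ℕ)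
    (h : ∀ a, p a → f a ∈ s) :
    Nat.card {a // p a} = ∑ t ∈ s, Nat.card {a // p a ∧ f a = t} := by
  classical
  have := Fintype.ofFinite α
  simp only [Nat.card_eq_fintype_card, Fintype.card_subtype]
  rw [Finset.card_eq_sum_card_fiberwise (f := f) (t := s)]
  · simp only [Finset.filter_filter]
  · intro a ha
    simpa using h a (by simpa using ha)

theorem natCard_subtype_eq_mul {α β : Type*} [Finite α] [Finite β] (p : α → Prop) (r : β → Prop)
    (f : α → β) (c : ℚ) (hf : ∀ a, p a → r (f a))
    (h : ∀ b, r b → (Nat.card {a // p a ∧ f a = b} : ℚ) = c) :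
    (Nat.card {a // p a} : ℚ) = Nat.card {b // r b} * c := by
  classical
  have := Fintype.ofFinite α
  have := Fintype.ofFinite β
  simp only [Nat.card_eq_fintype_card, Fintype.card_subtype] at h ⊢
  rw [Finset.card_eq_sum_card_fiberwise (f := f) (t := Finset.univ.filter r), Nat.cast_sum,
    Finset.sum_congr rfl (g := fun _ => c), Finset.sum_const, nsmul_eq_mul]
  · intro b hb
    rw [Finset.filter_filter, h b (by simpa using hb)]
  · intro a ha
    simpa using hf a (by simpa using ha)

end Counting

section Surjective

variable {F E : Type*} [Field F] [AddCommGroup E] [Module F E]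

/-- The correspondence theorem as a count: it serves both to pass to quotients and to transport
along isomorphisms. -/
theorem natCard_ker_le {E' : Type*} [AddCommGroup E'] [Module F E'] (g : E →ₗ[F] E')
    (hg : Function.Surjective g) (p : Submodule F E → Prop) (hp : ∀ V, p V → g.ker ≤ V) :
    Nat.card {V // p V} = Nat.card {V' : Submodule F E' // p (V'.comap g)} := by
  refine Nat.card_congr ⟨fun V => ⟨V.1.map g, ?_⟩, fun V' => ⟨V'.1.comap g, V'.2⟩, ?_, ?_⟩
  · rw [Submodule.comap_map_eq_self (hp _ V.2)]
    exact V.2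
  · intro V
    exact Subtype.ext (Submodule.comap_map_eq_self (hp _ V.2))
  · intro V'
    exact Subtype.ext (Submodule.map_comap_eq_of_surjective hg _)

theorem finrank_comap_of_surjective [FiniteDimensional F E] {E' : Type*} [AddCommGroup E']
    [Module F E'] (g : E →ₗ[F] E')
    (hg : Function.Surjective g) (V : Submodule F E') :
    finrank F (V.comap g) = finrank F V + finrank F g.ker := by
  have h := (g.domRestrict (V.comap g)).finrank_range_add_finrank_ker
  have h1 : (g.domRestrict (V.comap g)).range = V := by
    rw [LinearMap.range_domRestrict, Submodule.map_comap_eq_of_surjective hg]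
  have h2 : finrank F (g.domRestrict (V.comap g)).ker = finrank F g.ker := by
    rw [LinearMap.ker_domRestrict, ← Submodule.finrank_map_subtype_eq, Submodule.map_comap_subtype,
      inf_eq_right.2]
    exact fun x hx => by simp [LinearMap.mem_ker.1 hx]
  rw [h1, h2] at h
  exact h.symm

end Surjective

/-! ### Subspaces as graphs of linear maps. -/

section Graphs

variable {F E B : Type*} [Field F] [AddCommGroup E] [Module F E] [Finite E]
  [AddCommGroup B] [Module F B] [Finite B]

/-- A subspace meeting 0 × B trivially is the graph of a unique linear map from its first projection
X to B. The predicate `p` leaves room for a further condition on that map, such as injectivity. -/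
theorem natCard_submodule_prod (m : ℕ) (c : ℚ) (p : Submodule F (E × B) → Prop)
    (hp : ∀ X : Submodule F E, finrank F X = m →
      (Nat.card {f : X →ₗ[F] B // p (X.subtype.prod f).range} : ℚ) = c) :
    (Nat.card {V : Submodule F (E × B) //
      V.comap (.inr F E B) = ⊥ ∧ finrank F V = m ∧ p V} : ℚ) =
      Nat.card {X : Submodule F E // finrank F X = m} * c := by
  have key : ∀ V : Submodule F (E × B), V.comap (.inr F E B) = ⊥ →
      finrank F (V.map (.fst F E B)) = finrank F V := by
    intro V hV
    have h := (LinearMap.domRestrict (.fst F E B) V).finrank_range_add_finrank_ker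
    rw [LinearMap.range_domRestrict, LinearMap.ker_eq_bot'.2, finrank_bot, add_zero] at h
    · exact h
    · rintro ⟨⟨x, y⟩, hxy⟩ h
      obtain rfl : x = 0 := h
      have : y ∈ V.comap (.inr F E B) := hxy
      rw [hV, Submodule.mem_bot] at this
      simp [this]
  refine natCard_subtype_eq_mul _ _ (fun V => V.map (.fst F E B)) c
    (fun V hV => (key V hV.1).trans hV.2.1) fun X hX => ?_
  rw [← hp X hX]
  have mem : ∀ (f : X →ₗ[F] B) (x : E) (y : B), (x, y) ∈ (X.subtype.prod f).range ↔
      ∃ h : x ∈ X, f ⟨x, h⟩ = y := by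
    intro f x y
    constructor
    · rintro ⟨z, hz⟩
      obtain ⟨rfl, rfl⟩ := Prod.mk.inj hz
      exact ⟨z.2, rfl⟩
    · rintro ⟨h, rfl⟩
      exact ⟨⟨x, h⟩, rfl⟩
  have comap_inr : ∀ f : X →ₗ[F] B, (X.subtype.prod f).range.comap (.inr F E B) = ⊥ := by
    intro f
    rw [eq_bot_iff]
    intro y hy
    obtain ⟨h, rfl⟩ := (mem f 0 y).1 hy
    exact f.map_zero
  have map_fst : ∀ f : X →ₗ[F] B, (X.subtype.prod f).range.map (.fst F E B) = X := by
    intro f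
    rw [← LinearMap.range_comp, LinearMap.fst_prod, Submodule.range_subtype]
  congr 1
  symm
  refine Nat.card_congr (Equiv.ofBijective (fun f => ⟨(X.subtype.prod f.1).range,
    ⟨comap_inr f.1, ?_, f.2⟩, map_fst f.1⟩) ⟨fun f f' h => ?_, ?_⟩)
  · rw [← key _ (comap_inr f.1), map_fst, hX]
  · ext x
    have h1 := (mem f.1 x _).2 ⟨x.2, rfl⟩
    have h' : (X.subtype.prod f.1).range = (X.subtype.prod f'.1).range := congrArg Subtype.val h
    rw [h'] at h1
    obtain ⟨_, h2⟩ := (mem f'.1 x _).1 h1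
    exact h2.symm
  · rintro ⟨V, ⟨h1, h2, h3⟩, rfl⟩
    have hV : ∀ (x : E × B), x ∈ V → x.1 = 0 → x.2 = 0 := by
      rintro ⟨x, y⟩ hx rfl
      have : y ∈ V.comap (.inr F E B) := hx
      rwa [h1, Submodule.mem_bot] at this
    obtain ⟨g, hg⟩ : ∃ g : V.map (.fst F E B) →ₗ[F] B, ∀ x, (x.1, g x) ∈ V :=
      ⟨V.toLinearPMap.toFun, fun x => V.mem_graph_toLinearPMap hV x⟩
    have hr : ((V.map (.fst F E B)).subtype.prod g).range = V := by
      ext ⟨x, y⟩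
      rw [mem]
      constructor
      · rintro ⟨h, rfl⟩
        exact hg ⟨x, h⟩
      · intro hxy
        have h : x ∈ V.map (.fst F E B) := ⟨_, hxy, rfl⟩
        refine ⟨h, sub_eq_zero.1 ?_⟩
        exact hV _ (V.sub_mem (hg ⟨x, h⟩) hxy) (sub_self x)
    exact ⟨⟨g, by rwa [hr]⟩, Subtype.ext hr⟩

end Graphs

/-! ### Gaussian coefficients as numbers of subspaces. -/

section Subspaces

variable {F : Type*} [Field F] [Fintype F]
variable {E : Type*} [AddCommGroup E] [Module F E] [Finite E]
variable {B : Type*} [AddCommGroup B] [Module F B] [Finite B]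

local notation "q" => Fintype.card F

theorem natCard_linearIndependent (t : ℕ) :
    (Nat.card {s : Fin t → E // LinearIndependent F s} : ℚ) =
      ∏ i ∈ Finset.range t, ((q : ℚ) ^ finrank F E - (q : ℚ) ^ i) := by
  rcases le_or_gt t (finrank F E) with h | h
  · rw [card_linearIndependent h, Finset.prod_range, Nat.cast_prod]
    refine Finset.prod_congr rfl fun i _ => ?_
    rw [Nat.cast_sub (Nat.pow_le_pow_right Fintype.card_pos (i.2.le.trans h))]
    push_cast
    rfl
  -- Above the dimension both sides vanish: the product contains the factor i = dim E.
  · rw [Finset.prod_eq_zero (Finset.mem_range.2 h) (sub_self _)]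
    have : IsEmpty {s : Fin t → E // LinearIndependent F s} :=
      ⟨fun s => by
        have := s.2.fintype_card_le_finrank
        rw [Fintype.card_fin] at this
        omega⟩
    simp

theorem natCard_injective_linearMap :
    (Nat.card {f : E →ₗ[F] B // Function.Injective f} : ℚ) =
      ∏ i ∈ Finset.range (finrank F E), ((q : ℚ) ^ finrank F B - (q : ℚ) ^ i) := by
  rw [← natCard_linearIndependent]
  congr 1
  refine (Nat.card_congr (Equiv.subtypeEquiv ((finBasis F E).constr F).toEquiv fun s => ?_)).symm
  have : ⇑((finBasis F E).constr F s) =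
      Finsupp.linearCombination F s ∘ (finBasis F E).repr := by
    ext x
    rw [Basis.constr_apply]
    rfl
  change _ ↔ Function.Injective ((finBasis F E).constr F s)
  rw [this, EquivLike.injective_comp]
  rfl

theorem prod_pow_sub_pow_ne_zero (m : ℕ) :
    ∏ i ∈ Finset.range m, ((q : ℚ) ^ m - (q : ℚ) ^ i) ≠ 0 := by
  refine Finset.prod_ne_zero_iff.2 fun i hi => sub_ne_zero.2 (ne_of_gt ?_)
  exact pow_lt_pow_right₀ (by exact_mod_cast Fintype.one_lt_card) (Finset.mem_range.1 hi)

/-- Each independent m-tuple is an ordered basis of its span, and every m-dimensional space has the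
same number of ordered bases. -/
theorem natCard_submodule_finrank (m : ℕ) :
    (Nat.card {V : Submodule F E // finrank F V = m} : ℚ) = gaussCoeff q (finrank F E) m := by
  rw [gaussCoeff, eq_div_iff (prod_pow_sub_pow_ne_zero m), ← natCard_linearIndependent]
  refine (natCard_subtype_eq_mul (fun s : Fin m → E => LinearIndependent F s) _
    (fun s => Submodule.span F (Set.range s)) _ (fun s hs => ?_) fun V hV => ?_).symm
  · rw [finrank_span_eq_card hs, Fintype.card_fin]
  · rw [← hV, ← natCard_linearIndependent, hV]
    congr 1
    symm
    refine Nat.card_congr (Equiv.ofBijective (fun s => ⟨fun i => (s.1 i : E),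
      s.2.map' V.subtype V.ker_subtype, ?_⟩) ⟨fun s s' h => ?_, fun s => ?_⟩)
    · refine Submodule.eq_of_le_of_finrank_eq (Submodule.span_le.2 ?_) ?_
      · rintro _ ⟨i, rfl⟩
        exact (s.1 i).2
      · have := finrank_span_eq_card (s.2.map' V.subtype V.ker_subtype)
        rw [Fintype.card_fin] at this
        exact this.trans hV.symm
    · ext i
      exact congrFun (congrArg Subtype.val h) i
    · have hs : ∀ i, s.1 i ∈ V := fun i => s.2.2.le (Submodule.subset_span ⟨i, rfl⟩)
      refine ⟨⟨fun i => ⟨s.1 i, hs i⟩, ?_⟩, rfl⟩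
      exact LinearIndependent.of_comp V.subtype s.2.1

end Subspaces

/-- These bounds make the truncated subtractions below exact and confine t to the summation range of
N. -/
theorem finrank_comap_inl_add_le {F E B : Type*} [Field F] [AddCommGroup E] [Module F E]
    [FiniteDimensional F E] [AddCommGroup B] [Module F B] [FiniteDimensional F B]
    (V : Submodule F (E × B)) :
    finrank F (V.comap (.inl F E B)) + finrank F (V.comap (.inr F E B)) ≤ finrank F V ∧
    finrank F V ≤ finrank F E + finrank F (V.comap (.inr F E B)) ∧
    finrank F V ≤ finrank F (V.comap (.inl F E B)) + finrank F B := by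
  have hi₁ : Function.Injective (LinearMap.inl F E B) := LinearMap.inl_injective
  have hi₂ : Function.Injective (LinearMap.inr F E B) := LinearMap.inr_injective
  have e₁ := (LinearEquiv.finrank_eq (Submodule.equivMapOfInjective _ hi₁ (V.comap (.inl F E B))))
  have e₂ := (LinearEquiv.finrank_eq (Submodule.equivMapOfInjective _ hi₂ (V.comap (.inr F E B))))
  have r₁ := LinearMap.finrank_range_of_inj hi₁
  have r₂ := LinearMap.finrank_range_of_inj hi₂
  rw [Submodule.map_comap_eq] at e₁ e₂
  have hd : Disjoint (LinearMap.range (.inl F E B)) (LinearMap.range (.inr F E B)) :=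
    LinearMap.isCompl_range_inl_inr.disjoint
  have s₁ := Submodule.finrank_sup_add_finrank_inf_eq (LinearMap.range (.inl F E B)) V
  have s₂ := Submodule.finrank_sup_add_finrank_inf_eq (LinearMap.range (.inr F E B)) V
  have l₁ := Submodule.finrank_le (LinearMap.range (.inl F E B) ⊔ V)
  have l₂ := Submodule.finrank_le (LinearMap.range (.inr F E B) ⊔ V)
  have s := Submodule.finrank_sup_add_finrank_inf_eq
    (LinearMap.range (.inl F E B) ⊓ V) (LinearMap.range (.inr F E B) ⊓ V)
  rw [(hd.mono inf_le_left inf_le_left).eq_bot, finrank_bot] at s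
  have l := Submodule.finrank_mono (sup_le (inf_le_right : LinearMap.range (.inl F E B) ⊓ V ≤ V)
    (inf_le_right : LinearMap.range (.inr F E B) ⊓ V ≤ V))
  rw [finrank_prod] at l₁ l₂
  omega

/-! ### Counting subspaces by their intersections with summands. -/

section ProductCounting

variable {F : Type*} [Field F] [Fintype F]
variable {E : Type*} [AddCommGroup E] [Module F E] [Finite E]
variable {B : Type*} [AddCommGroup B] [Module F B] [Finite B]

local notation "q" => Fintype.card F

theorem natCard_comap_inr_eq_bot (m : ℕ) :
    (Nat.card {V : Submodule F (E × B) // V.comap (.inr F E B) = ⊥ ∧ finrank F V = m} : ℚ) =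
      (q : ℚ) ^ (finrank F B * m) * gaussCoeff q (finrank F E) m := by
  have h := natCard_submodule_prod (F := F) (E := E) (B := B) m ((q : ℚ) ^ (finrank F B * m))
    (fun _ => True) fun X hX => by
      rw [Nat.card_congr (Equiv.subtypeUnivEquiv fun _ => trivial),
        Module.natCard_eq_pow_finrank (K := F), Module.finrank_linearMap, hX, mul_comm,
        Nat.card_eq_fintype_card, Nat.cast_pow]
  simp only [and_true] at h
  rw [h, natCard_submodule_finrank, mul_comm]

theorem prod_pow_sub_pow_eq (b t : ℕ) :
    ∏ i ∈ Finset.range t, ((q : ℚ) ^ b - (q : ℚ) ^ i) =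
      (∏ i ∈ Finset.range t, ((q : ℚ) ^ t - (q : ℚ) ^ i)) * gaussCoeff q b t := by
  rw [gaussCoeff, mul_div_cancel₀ _ (prod_pow_sub_pow_ne_zero t)]

/-- Trivial intersection with E × 0 says that the map whose graph is V is injective. -/
theorem natCard_comap_eq_bot (t : ℕ) :
    (Nat.card {V : Submodule F (E × B) // V.comap (.inl F E B) = ⊥ ∧ V.comap (.inr F E B) = ⊥ ∧
      finrank F V = t} : ℚ) =
      (∏ i ∈ Finset.range t, ((q : ℚ) ^ t - (q : ℚ) ^ i)) *
        gaussCoeff q (finrank F E) t * gaussCoeff q (finrank F B) t := by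
  have h := natCard_submodule_prod (F := F) (E := E) (B := B) t
    (∏ i ∈ Finset.range t, ((q : ℚ) ^ finrank F B - (q : ℚ) ^ i))
    (fun V => V.comap (.inl F E B) = ⊥) fun X hX => by
      subst hX
      rw [← natCard_injective_linearMap]
      congr 1
      refine Nat.card_congr (Equiv.subtypeEquivRight fun f => ?_)
      rw [← LinearMap.ker_eq_bot, LinearMap.ker_eq_bot', eq_bot_iff]
      constructor
      · intro h x hx
        have : (x : E) ∈ (X.subtype.prod f).range.comap (.inl F E B) :=
          ⟨x, Prod.ext rfl hx⟩
        exact Subtype.ext (h this)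
      · rintro h _ ⟨x, hx⟩
        obtain ⟨rfl, hx⟩ := Prod.mk.inj hx
        simp [h x hx]
  rw [natCard_submodule_finrank, prod_pow_sub_pow_eq] at h
  refine Eq.trans ?_ (h.trans (by ring))
  congr 1
  exact Nat.card_congr (Equiv.subtypeEquivRight fun V => by tauto)

/-- Such V contain 0 × U; dividing by it reduces to trivial intersection with B ⧸ U. -/
theorem natCard_comap_inr_eq (U : Submodule F B) (m : ℕ) :
    (Nat.card {V : Submodule F (E × B) // V.comap (.inr F E B) = U ∧ finrank F V = m} : ℚ) =
      if finrank F U ≤ m then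
        (q : ℚ) ^ ((finrank F B - finrank F U) * (m - finrank F U)) *
          gaussCoeff q (finrank F E) (m - finrank F U)
      else 0 := by
  set g : E × B →ₗ[F] E × (B ⧸ U) := LinearMap.id.prodMap U.mkQ with hg
  have hs : Function.Surjective g := Function.surjective_id.prodMap U.mkQ_surjective
  have hk : g.ker = (⊥ : Submodule F E).prod U := by
    rw [hg, LinearMap.ker_prodMap, LinearMap.ker_id, Submodule.ker_mkQ]
  have : Finite (B ⧸ U) := Module.finite_of_finite F
  have hU := U.finrank_quotient_add_finrank
  have hkf : finrank F g.ker = finrank F U := by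
    have h := g.finrank_range_add_finrank_ker
    rw [LinearMap.range_eq_top.2 hs, finrank_top, finrank_prod, finrank_prod] at h
    omega
  have hc : ∀ V' : Submodule F (E × (B ⧸ U)),
      (V'.comap g).comap (.inr F E B) = (V'.comap (.inr F E (B ⧸ U))).comap U.mkQ := fun V' => rfl
  have hbot : ∀ V' : Submodule F (E × (B ⧸ U)), (V'.comap g).comap (.inr F E B) = U ↔
      V'.comap (.inr F E (B ⧸ U)) = ⊥ := by
    intro V'
    rw [hc, ← (Submodule.comap_injective_of_surjective U.mkQ_surjective).eq_iff,
      Submodule.comap_bot, Submodule.ker_mkQ]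
  rw [natCard_ker_le g hs]
  · split_ifs with h
    · rw [← U.finrank_quotient, ← natCard_comap_inr_eq_bot]
      congr 1
      refine Nat.card_congr (Equiv.subtypeEquivRight fun V' => and_congr (hbot V') ?_)
      rw [finrank_comap_of_surjective g hs, hkf]
      omega
    · rw [Nat.cast_eq_zero, Nat.card_eq_zero]
      refine Or.inl ⟨fun V' => h ?_⟩
      have := V'.2.2
      rw [finrank_comap_of_surjective g hs, hkf] at this
      omega
  · rintro V ⟨rfl, -⟩
    rw [hk]
    rintro ⟨x, y⟩ ⟨hx, hy⟩
    obtain rfl : x = 0 := hx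
    exact hy

/-- As in Goursat's lemma: dividing by T₁ × T₂ leaves a t-dimensional subspace meeting both factors
trivially. -/
theorem natCard_comap_eq (T₁ : Submodule F E) (T₂ : Submodule F B) (t : ℕ) :
    (Nat.card {V : Submodule F (E × B) // V.comap (.inl F E B) = T₁ ∧ V.comap (.inr F E B) = T₂ ∧
      finrank F V = t + finrank F T₁ + finrank F T₂} : ℚ) =
      (∏ i ∈ Finset.range t, ((q : ℚ) ^ t - (q : ℚ) ^ i)) *
        gaussCoeff q (finrank F E - finrank F T₁) t *
        gaussCoeff q (finrank F B - finrank F T₂) t := by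
  set g : E × B →ₗ[F] (E ⧸ T₁) × (B ⧸ T₂) := T₁.mkQ.prodMap T₂.mkQ with hg
  have hs : Function.Surjective g := T₁.mkQ_surjective.prodMap T₂.mkQ_surjective
  have hk : g.ker = T₁.prod T₂ := by
    rw [hg, LinearMap.ker_prodMap, Submodule.ker_mkQ, Submodule.ker_mkQ]
  have : Finite (E ⧸ T₁) := Module.finite_of_finite F
  have : Finite (B ⧸ T₂) := Module.finite_of_finite F
  have h₁ := T₁.finrank_quotient_add_finrank
  have h₂ := T₂.finrank_quotient_add_finrank
  have hkf : finrank F g.ker = finrank F T₁ + finrank F T₂ := by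
    have h := g.finrank_range_add_finrank_ker
    rw [LinearMap.range_eq_top.2 hs, finrank_top, finrank_prod, finrank_prod] at h
    omega
  have hl : ∀ V' : Submodule F ((E ⧸ T₁) × (B ⧸ T₂)), (V'.comap g).comap (.inl F E B) =
      (V'.comap (.inl F (E ⧸ T₁) (B ⧸ T₂))).comap T₁.mkQ := by
    intro V'
    ext x
    simp [hg]
  have hr : ∀ V' : Submodule F ((E ⧸ T₁) × (B ⧸ T₂)), (V'.comap g).comap (.inr F E B) =
      (V'.comap (.inr F (E ⧸ T₁) (B ⧸ T₂))).comap T₂.mkQ := by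
    intro V'
    ext x
    simp [hg]
  rw [natCard_ker_le g hs, ← T₁.finrank_quotient, ← T₂.finrank_quotient, ← natCard_comap_eq_bot]
  · congr 1
    refine Nat.card_congr (Equiv.subtypeEquivRight fun V' => and_congr ?_ (and_congr ?_ ?_))
    · rw [hl, ← (Submodule.comap_injective_of_surjective T₁.mkQ_surjective).eq_iff (b := ⊥),
        Submodule.comap_bot, Submodule.ker_mkQ]
    · rw [hr, ← (Submodule.comap_injective_of_surjective T₂.mkQ_surjective).eq_iff (b := ⊥),
        Submodule.comap_bot, Submodule.ker_mkQ]
    · rw [finrank_comap_of_surjective g hs, hkf]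
      omega
  · rintro V ⟨rfl, rfl, -⟩
    rw [hk]
    rintro ⟨x, y⟩ ⟨hx, hy⟩
    have := V.add_mem hx hy
    simpa using this

theorem natCard_finrank_comap_eq (t₁ t₂ t : ℕ) :
    (Nat.card {V : Submodule F (E × B) // finrank F (V.comap (.inl F E B)) = t₁ ∧
      finrank F (V.comap (.inr F E B)) = t₂ ∧ finrank F V = t + t₁ + t₂} : ℚ) =
      innerCount q (finrank F E) (finrank F B) t₁ t₂ t := by
  have h := natCard_subtype_eq_mul (fun V : Submodule F (E × B) =>
      finrank F (V.comap (.inl F E B)) = t₁ ∧ finrank F (V.comap (.inr F E B)) = t₂ ∧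
        finrank F V = t + t₁ + t₂)
    (fun T : Submodule F E × Submodule F B => finrank F T.1 = t₁ ∧ finrank F T.2 = t₂)
    (fun V => (V.comap (.inl F E B), V.comap (.inr F E B)))
    ((∏ i ∈ Finset.range t, ((q : ℚ) ^ t - (q : ℚ) ^ i)) *
      gaussCoeff q (finrank F E - t₁) t * gaussCoeff q (finrank F B - t₂) t)
    (fun V hV => ⟨hV.1, hV.2.1⟩) <| by
      rintro ⟨T₁, T₂⟩ ⟨rfl, rfl⟩
      dsimp only
      rw [← natCard_comap_eq]
      congr 1
      refine Nat.card_congr (Equiv.subtypeEquivRight fun V => ?_)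
      rw [Prod.mk.injEq]
      constructor
      · rintro ⟨⟨-, -, h⟩, h₁, h₂⟩
        exact ⟨h₁, h₂, h⟩
      · rintro ⟨rfl, rfl, h⟩
        exact ⟨⟨rfl, rfl, h⟩, rfl, rfl⟩
  have h' : Nat.card {T : Submodule F E × Submodule F B //
        finrank F T.1 = t₁ ∧ finrank F T.2 = t₂} =
      Nat.card ({U : Submodule F E // finrank F U = t₁} ×
        {U : Submodule F B // finrank F U = t₂}) :=
    Nat.card_congr ⟨fun T => (⟨T.1.1, T.2.1⟩, ⟨T.1.2, T.2.2⟩),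
      fun T => ⟨(T.1.1, T.2.1), T.1.2, T.2.2⟩, fun _ => rfl, fun _ => rfl⟩
  rw [h, h', Nat.card_prod, Nat.cast_mul,
    natCard_submodule_finrank, natCard_submodule_finrank, innerCount]
  ring

theorem gaussCoeff_eq_zero {a b : ℕ} (h : a < b) (x : ℕ) : gaussCoeff x a b = 0 := by
  rw [gaussCoeff, Finset.prod_eq_zero (Finset.mem_range.2 h) (sub_self _), zero_div]

theorem outerCount_eq_zero {x k m u₁ u₂ t₁ t₂ : ℕ} (h : u₁ < t₁ ∨ u₂ < t₂) :
    outerCount x k m u₁ u₂ t₁ t₂ = 0 := by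
  refine Finset.sum_eq_zero fun t _ => ?_
  rcases h with h | h <;> simp [innerCount, gaussCoeff_eq_zero h]

theorem natCard_finrank_comap_prod {A : Type*} [AddCommGroup A] [Module F A] [Finite A]
    (m t₁ t₂ : ℕ) :
    (Nat.card {V : Submodule F (A × (E × B)) //
      finrank F V = m ∧ finrank F ((V.comap (.inr F A (E × B))).comap (.inl F E B)) = t₁ ∧
      finrank F ((V.comap (.inr F A (E × B))).comap (.inr F E B)) = t₂} : ℚ) =
      outerCount q (finrank F A + finrank F E + finrank F B) m (finrank F E) (finrank F B)
        t₁ t₂ := by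
  by_cases h : finrank F E < t₁ ∨ finrank F B < t₂
  · rw [outerCount_eq_zero h, Nat.cast_eq_zero, Nat.card_eq_zero]
    refine Or.inl ⟨?_⟩
    rintro ⟨V, -, rfl, rfl⟩
    exact h.elim (Submodule.finrank_le _).not_gt (Submodule.finrank_le _).not_gt
  have hbd : ∀ V : Submodule F (E × B), _ := finrank_comap_inl_add_le
  -- The index t is the excess of dim W over t₁ + t₂, where W = V ∩ (E × B); for each t the V are
  -- then counted over the possible W.
  rw [natCard_subtype_eq_sum _ (fun V => finrank F (V.comap (.inr F A (E × B))) - (t₁ + t₂))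
    (Finset.range (min (finrank F E - t₁) (finrank F B - t₂) + 1)), Nat.cast_sum, outerCount]
  · refine Finset.sum_congr rfl fun t ht => ?_
    rw [Finset.mem_range] at ht
    rw [natCard_subtype_eq_mul _ (fun U : Submodule F (E × B) =>
      finrank F (U.comap (.inl F E B)) = t₁ ∧
      finrank F (U.comap (.inr F E B)) = t₂ ∧ finrank F U = t + t₁ + t₂)
      (fun V => V.comap (.inr F A (E × B)))
      (if t + t₁ + t₂ ≤ m then (q : ℚ) ^ ((finrank F (E × B) - (t + t₁ + t₂)) *
        (m - (t + t₁ + t₂))) * gaussCoeff q (finrank F A) (m - (t + t₁ + t₂)) else 0),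
      natCard_finrank_comap_eq]
    · have e : finrank F A + finrank F E + finrank F B - finrank F E - finrank F B =
        finrank F A := by omega
      rw [finrank_prod, e]
      split_ifs
      · ring
      · ring
    · rintro V ⟨⟨-, rfl, rfl⟩, h'⟩
      have := hbd (V.comap (.inr F A (E × B)))
      exact ⟨rfl, rfl, by omega⟩
    · rintro U ⟨h₁, h₂, h₃⟩
      rw [← h₃, ← natCard_comap_inr_eq]
      congr 1
      refine Nat.card_congr (Equiv.subtypeEquivRight fun V => ?_)
      constructor
      · rintro ⟨⟨⟨h, -⟩, -⟩, e⟩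
        exact ⟨e, h⟩
      · rintro ⟨rfl, h⟩
        exact ⟨⟨⟨h, h₁, h₂⟩, by omega⟩, rfl⟩
  · rintro V ⟨-, h₁, h₂⟩
    have := hbd (V.comap (.inr F A (E × B)))
    rw [h₁, h₂] at this
    rw [Finset.mem_range]
    omega

theorem natCard_finrank_comap_subtype (S₁ S₂ : Submodule F E) (hS : S₁ ⊓ S₂ = ⊥) (m t₁ t₂ : ℕ) :
    (Nat.card {V : Submodule F E // finrank F V = m ∧ finrank F (V.comap S₁.subtype) = t₁ ∧
      finrank F (V.comap S₂.subtype) = t₂} : ℚ) =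
      outerCount q (finrank F E) m (finrank F S₁) (finrank F S₂) t₁ t₂ := by
  obtain ⟨K, hK⟩ := (S₁ ⊔ S₂).exists_isCompl
  set g : (K × (S₁ × S₂)) →ₗ[F] E := K.subtype.coprod (S₁.subtype.coprod S₂.subtype) with hg
  have hgr : g.range = ⊤ := by
    rw [hg, LinearMap.range_coprod, LinearMap.range_coprod, Submodule.range_subtype,
      Submodule.range_subtype, Submodule.range_subtype, sup_comm, hK.sup_eq_top]
  have hf : finrank F (K × (S₁ × S₂)) = finrank F E := by
    have h₁ := Submodule.finrank_add_eq_of_isCompl hK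
    have h₂ := Submodule.finrank_sup_add_finrank_inf_eq S₁ S₂
    rw [hS, finrank_bot] at h₂
    rw [finrank_prod, finrank_prod]
    omega
  have hs := LinearMap.range_eq_top.1 hgr
  have hi : Function.Injective g :=
    (LinearMap.injective_iff_surjective_of_finrank_eq_finrank hf).2 hs
  have hk := LinearMap.ker_eq_bot.2 hi
  rw [← hf, finrank_prod, finrank_prod, ← add_assoc, ← natCard_finrank_comap_prod,
    natCard_ker_le g hs _ (fun V _ => hk.trans_le bot_le)]
  congr 1
  refine Nat.card_congr (Equiv.subtypeEquivRight fun V => ?_)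
  have h₁ : ((V.comap g).comap (.inr F K (S₁ × S₂))).comap (.inl F S₁ S₂) =
      V.comap S₁.subtype := by
    ext x
    simp [hg]
  have h₂ : ((V.comap g).comap (.inr F K (S₁ × S₂))).comap (.inr F S₁ S₂) =
      V.comap S₂.subtype := by
    ext x
    simp [hg]
  rw [h₁, h₂, finrank_comap_of_surjective g hs, hk, finrank_bot, add_zero]

end ProductCounting

/-! ### Inequalities between powers, and positivity of N. -/

section Arithmetic

/-- The larger exponent is determined: if a ≤ b < d, then x^a + x^b ≤ 2x^b ≤ x^d < x^c + x^d. -/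
theorem pow_add_pow_eq_iff {x : ℕ} (hx : 2 ≤ x) {s₁ s₂ t₁ t₂ : ℕ} :
    x ^ s₁ + x ^ s₂ = x ^ t₁ + x ^ t₂ ↔ (s₁ = t₁ ∧ s₂ = t₂) ∨ (s₁ = t₂ ∧ s₂ = t₁) := by
  have key : ∀ a b c d : ℕ, a ≤ b → c ≤ d → b < d → x ^ a + x ^ b ≠ x ^ c + x ^ d := by
    intro a b c d hab _ hbd h
    have h1 : x ^ a ≤ x ^ b := Nat.pow_le_pow_right (by omega) hab
    have h2 : x ^ (b + 1) ≤ x ^ d := Nat.pow_le_pow_right (by omega) hbd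
    have h3 : 2 * x ^ b ≤ x ^ (b + 1) := by
      rw [pow_succ, mul_comm]
      exact Nat.mul_le_mul_left _ hx
    have h4 : 0 < x ^ c := Nat.pow_pos (by omega)
    omega
  have sorted : ∀ a b c d : ℕ, a ≤ b → c ≤ d → x ^ a + x ^ b = x ^ c + x ^ d → a = c ∧ b = d := by
    intro a b c d hab hcd h
    rcases lt_trichotomy b d with hbd | rfl | hbd
    · exact (key a b c d hab hcd hbd h).elim
    · exact ⟨Nat.pow_right_injective hx (Nat.add_right_cancel h), rfl⟩
    · exact (key c d a b hcd hab hbd h.symm).elim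
  constructor
  · intro h
    rcases le_total s₁ s₂ with hs | hs <;> rcases le_total t₁ t₂ with ht | ht
    · exact Or.inl (sorted _ _ _ _ hs ht h)
    · exact Or.inr (sorted _ _ _ _ hs ht (by omega))
    · have := sorted _ _ _ _ hs ht (by omega)
      omega
    · have := sorted _ _ _ _ hs ht (by omega)
      omega
  · rintro (⟨rfl, rfl⟩ | ⟨rfl, rfl⟩)
    · rfl
    · exact add_comm _ _

/-- Up to the common +1, the sides count all columns and the columns in a hyperplane meeting S_r in
dimension s_r. Each x^u_r - x^s_r is 0 or (x - 1)x^s_r. -/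
theorem pow_sub_pow_sub_pow_ne {x : ℤ} (hx : 2 ≤ x) {k u₁ u₂ s₁ s₂ : ℕ} (hu₁ : u₁ < k)
    (hu₂ : u₂ < k) (hu : u₁ + u₂ ≤ k) (hexc : ¬ (x = 2 ∧ k = 2 ∧ u₁ = 1 ∧ u₂ = 1))
    (hs₁ : s₁ ≤ u₁) (hs₂ : s₂ ≤ u₂) (hs₁' : u₁ ≤ s₁ + 1) (hs₂' : u₂ ≤ s₂ + 1) :
    x ^ k - x ^ u₁ - x ^ u₂ ≠ x ^ (k - 1) - x ^ s₁ - x ^ s₂ := by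
  obtain ⟨b, rfl⟩ : ∃ b, k = b + 1 := ⟨k - 1, by omega⟩
  rw [Nat.add_sub_cancel]
  have lt : ∀ s, s < b → x ^ s < x ^ b := fun s hs => pow_lt_pow_right₀ (by omega) hs
  have hb : 0 < x ^ b := by positivity
  suffices h : x ^ u₁ - x ^ s₁ + (x ^ u₂ - x ^ s₂) < (x - 1) * x ^ b by
    intro h'
    rw [pow_succ] at h'
    linarith
  have hx1 : 0 < x - 1 := by omega
  rcases (by omega : u₁ = s₁ ∨ u₁ = s₁ + 1) with rfl | rfl <;>
    rcases (by omega : u₂ = s₂ ∨ u₂ = s₂ + 1) with rfl | rfl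
  · rw [sub_self, sub_self, add_zero]
    positivity
  · have := mul_lt_mul_of_pos_left (lt s₂ (by omega)) hx1
    rw [pow_succ]
    linarith
  · have := mul_lt_mul_of_pos_left (lt s₁ (by omega)) hx1
    rw [pow_succ]
    linarith
  -- The critical case: for b = 1 the inequality reads 2 < x, which fails exactly for the excluded
  -- parameters. For b ≥ 2, (x^s₁ - 1)(x^s₂ - 1) ≥ 0 bounds the sum by 1 + x^(s₁+s₂) ≤ 1 + x^(b-1).
  · have h : x ^ s₁ + x ^ s₂ < x ^ b := by
      rcases (by omega : b = 1 ∨ 2 ≤ b) with rfl | hb2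
      · obtain rfl : s₁ = 0 := by omega
        obtain rfl : s₂ = 0 := by omega
        have : x ≠ 2 := fun h => hexc ⟨h, rfl, rfl, rfl⟩
        simp only [pow_zero, pow_one]
        omega
      · obtain ⟨c, rfl⟩ : ∃ c, b = c + 2 := ⟨b - 2, by omega⟩
        have h1 : 1 ≤ x ^ s₁ := one_le_pow₀ (by omega)
        have h2 : 1 ≤ x ^ s₂ := one_le_pow₀ (by omega)
        have h3 : x ^ (s₁ + s₂) ≤ x ^ (c + 1) := pow_le_pow_right₀ (by omega) (by omega)
        have h4 : 2 ≤ x ^ (c + 1) := hx.trans (le_self_pow₀ (by omega) (by omega))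
        have h5 : 2 * x ^ (c + 1) ≤ x ^ (c + 2) := by
          rw [pow_succ x (c + 1), mul_comm]
          exact mul_le_mul_of_nonneg_left hx (by omega)
        have h6 := mul_nonneg (sub_nonneg.2 h1) (sub_nonneg.2 h2)
        rw [pow_add] at h3
        linarith [h6, h3]
    have := mul_lt_mul_of_pos_left h hx1
    rw [pow_succ, pow_succ]
    linarith

theorem gaussCoeff_pos {x a b : ℕ} (hx : 2 ≤ x) (h : b ≤ a) : 0 < gaussCoeff x a b := by
  have hx' : (1 : ℚ) < x := by exact_mod_cast hx
  refine div_pos (Finset.prod_pos fun i hi => ?_) (Finset.prod_pos fun i hi => ?_)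
  · exact sub_pos.2 (pow_lt_pow_right₀ hx' ((Finset.mem_range.1 hi).trans_le h))
  · exact sub_pos.2 (pow_lt_pow_right₀ hx' (Finset.mem_range.1 hi))

theorem gaussCoeff_nonneg {x : ℕ} (hx : 2 ≤ x) (a b : ℕ) : 0 ≤ gaussCoeff x a b :=
  (le_or_gt b a).elim (fun h => (gaussCoeff_pos hx h).le) fun h => (gaussCoeff_eq_zero h x).ge

theorem prod_pow_sub_pow_pos {x : ℕ} (hx : 2 ≤ x) (t : ℕ) :
    0 < ∏ i ∈ Finset.range t, ((x : ℚ) ^ t - (x : ℚ) ^ i) :=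
  Finset.prod_pos fun _ hi =>
    sub_pos.2 (pow_lt_pow_right₀ (by exact_mod_cast hx) (Finset.mem_range.1 hi))

theorem innerCount_nonneg {x : ℕ} (hx : 2 ≤ x) (u₁ u₂ t₁ t₂ t : ℕ) :
    0 ≤ innerCount x u₁ u₂ t₁ t₂ t := by
  have h := gaussCoeff_nonneg hx
  have := (prod_pow_sub_pow_pos hx t).le
  exact mul_nonneg (mul_nonneg (mul_nonneg (mul_nonneg this (h _ _)) (h _ _)) (h _ _)) (h _ _)

theorem innerCount_pos {x : ℕ} (hx : 2 ≤ x) {u₁ u₂ t₁ t₂ t : ℕ} (h₁ : t + t₁ ≤ u₁)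
    (h₂ : t + t₂ ≤ u₂) : 0 < innerCount x u₁ u₂ t₁ t₂ t :=
  mul_pos (mul_pos (mul_pos (mul_pos (prod_pow_sub_pow_pos hx t) (gaussCoeff_pos hx (by omega)))
    (gaussCoeff_pos hx (by omega))) (gaussCoeff_pos hx (by omega))) (gaussCoeff_pos hx (by omega))

theorem outerCount_pos {x k m u₁ u₂ t₁ t₂ : ℕ} (hx : 2 ≤ x) (t : ℕ) (h₁ : t + t₁ ≤ u₁)
    (h₂ : t + t₂ ≤ u₂) (hm : t + t₁ + t₂ ≤ m) (hk : m + u₁ + u₂ ≤ k + t + t₁ + t₂)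
    (hu : u₁ + u₂ ≤ k) : 0 < outerCount x k m u₁ u₂ t₁ t₂ := by
  have hx' : (0 : ℚ) < x := by exact_mod_cast (by omega : 0 < x)
  refine Finset.sum_pos' (fun s _ => ?_) ⟨t, Finset.mem_range.2 (by omega), ?_⟩
  · split_ifs
    · exact mul_nonneg (mul_nonneg (pow_pos hx' _).le (innerCount_nonneg hx ..))
        (gaussCoeff_nonneg hx ..)
    · exact le_rfl
  · rw [if_pos hm]
    exact mul_pos (mul_pos (pow_pos hx' _) (innerCount_pos hx h₁ h₂))
      (gaussCoeff_pos hx (by omega))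

end Arithmetic

/-! ### Intersection dimensions and numbers of points. -/

section Cardinality

variable {F E : Type*} [Field F] [AddCommGroup E] [Module F E]

theorem finrank_comap_subtype (V S : Submodule F E) :
    finrank F (V.comap S.subtype) = finrank F ↥(S ⊓ V) := by
  rw [← Submodule.finrank_map_subtype_eq, Submodule.map_comap_subtype]

theorem le_finrank_comap_subtype [FiniteDimensional F E] (V S : Submodule F E) :
    finrank F V + finrank F S ≤ finrank F (V.comap S.subtype) + finrank F E := by
  have h := Submodule.finrank_sup_add_finrank_inf_eq S V
  have := Submodule.finrank_le (S ⊔ V)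
  rw [finrank_comap_subtype]
  omega

theorem ncard_submodule [Fintype F] [Finite E] (V : Submodule F E) :
    (V : Set E).ncard = Fintype.card F ^ finrank F V := by
  rw [← Nat.card_eq_fintype_card, ← Module.natCard_eq_pow_finrank (K := F) (V := V)]
  rfl

/-- Inclusion-exclusion; the +1 is the zero vector, common to both subspaces. -/
theorem ncard_mem_sdiff [Fintype F] [Finite E] (S₁ S₂ : Submodule F E) (hS : S₁ ⊓ S₂ = ⊥)
    (V : Submodule F E) :
    ({x | x ∈ V ∧ ¬ (x ∈ S₁ ∨ x ∈ S₂)}.ncard : ℤ) =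
      (Fintype.card F : ℤ) ^ finrank F V -
        (Fintype.card F : ℤ) ^ finrank F (V.comap S₁.subtype) -
        (Fintype.card F : ℤ) ^ finrank F (V.comap S₂.subtype) + 1 := by
  have h₁ : {x | x ∈ V ∧ ¬ (x ∈ S₁ ∨ x ∈ S₂)} =
      (V : Set E) \ (((S₁ ⊓ V : Submodule F E) : Set E) ∪ ((S₂ ⊓ V : Submodule F E) : Set E)) := by
    ext x
    simp only [Set.mem_ofPred_eq, Set.mem_sdiff, Set.mem_union, SetLike.mem_coe, Submodule.mem_inf]
    tauto
  have h₂ := Set.ncard_sdiff_add_ncard_of_subset (s := ((S₁ ⊓ V : Submodule F E) : Set E) ∪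
    ((S₂ ⊓ V : Submodule F E) : Set E)) (t := (V : Set E)) (Set.union_subset
      (inf_le_right : S₁ ⊓ V ≤ V) (inf_le_right : S₂ ⊓ V ≤ V)) (Set.toFinite _)
  have h₃ := Set.ncard_union_add_ncard_inter ((S₁ ⊓ V : Submodule F E) : Set E)
    ((S₂ ⊓ V : Submodule F E) : Set E) (Set.toFinite _) (Set.toFinite _)
  have h₄ : ((S₁ ⊓ V : Submodule F E) : Set E) ∩ ((S₂ ⊓ V : Submodule F E) : Set E) = {0} := by
    rw [← Submodule.coe_inf, inf_inf_inf_comm, hS, bot_inf_eq, Submodule.bot_coe]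
  rw [h₄, Set.ncard_singleton, ncard_submodule, ncard_submodule] at h₃
  rw [← h₁, ncard_submodule] at h₂
  rw [finrank_comap_subtype, finrank_comap_subtype]
  zify at h₂ h₃
  linarith

end Cardinality

/-! ### Subcodes as annihilators of subspaces of the column space. -/

section Encoding

variable {F : Type*} [Field F] {k n : ℕ}

/-- Evaluation of linear functionals at the columns of a matrix. -/
def evalColumns (G : Matrix (Fin k) (Fin n) F) : Dual F (Fin k → F) →ₗ[F] (Fin n → F) :=
  LinearMap.pi fun c => Dual.eval F (Fin k → F) fun r => G r c

theorem evalColumns_apply (G : Matrix (Fin k) (Fin n) F) (f : Dual F (Fin k → F)) (c : Fin n) :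
    evalColumns G f c = f fun r => G r c :=
  rfl

theorem range_evalColumns (G : Matrix (Fin k) (Fin n) F) :
    LinearMap.range (evalColumns G) = rowCode G := by
  apply le_antisymm
  · rintro _ ⟨f, rfl⟩
    have : evalColumns G f = ∑ r, f (fun j => if r = j then 1 else 0) • fun c => G r c := by
      ext c
      rw [evalColumns_apply, LinearMap.pi_apply_eq_sum_univ f, Finset.sum_apply]
      exact Finset.sum_congr rfl fun r _ => by simp [mul_comm]
    rw [this]
    exact Submodule.sum_mem _ fun r _ => Submodule.smul_mem _ _ (Submodule.subset_span ⟨r, rfl⟩)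
  · refine Submodule.span_le.2 ?_
    rintro _ ⟨r, rfl⟩
    exact ⟨LinearMap.proj r, rfl⟩

/-- By biduality, a column lies in V exactly when every functional vanishing on V vanishes at it. -/
theorem supportWeight_add_ncard (G : Matrix (Fin k) (Fin n) F) (V : Submodule F (Fin k → F)) :
    supportWeight (V.dualAnnihilator.map (evalColumns G)) +
      {c : Fin n | (fun r => G r c) ∈ V}.ncard = n := by
  have h : {c : Fin n | ∃ x ∈ V.dualAnnihilator.map (evalColumns G), x c ≠ 0} =
      {c : Fin n | (fun r => G r c) ∈ V}ᶜ := by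
    ext c
    rw [Set.mem_compl_iff, Set.mem_ofPred_eq, Set.mem_ofPred_eq, ←
      Subspace.dualAnnihilator_dualCoannihilator_eq (W := V), Submodule.mem_dualCoannihilator,
      Subspace.dualAnnihilator_dualCoannihilator_eq]
    push Not
    constructor
    · rintro ⟨_, ⟨f, hf, rfl⟩, h⟩
      exact ⟨f, hf, h⟩
    · rintro ⟨f, hf, h⟩
      exact ⟨_, ⟨f, hf, rfl⟩, h⟩
  rw [supportWeight, h, add_comm, Set.ncard_add_ncard_compl, Nat.card_eq_fintype_card,
    Fintype.card_fin]

theorem ncard_column_mem {G : Matrix (Fin k) (Fin n) F} {T : Set (Fin k → F)}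
    (hG : IsMatrixOfSet G T) (V : Submodule F (Fin k → F)) :
    {c : Fin n | (fun r => G r c) ∈ V}.ncard = {x | x ∈ V ∧ x ∈ T}.ncard := by
  have h := Set.injOn_univ.1 hG.injOn
  rw [← Set.ncard_image_of_injective _ h]
  congr 1
  ext x
  constructor
  · rintro ⟨c, hc, rfl⟩
    exact ⟨hc, hG.mapsTo (Set.mem_univ c)⟩
  · rintro ⟨hx, hxT⟩
    obtain ⟨c, -, rfl⟩ := hG.surjOn hxT
    exact ⟨c, hx, rfl⟩

theorem map_evalColumns_dualAnnihilator_injective {G : Matrix (Fin k) (Fin n) F}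
    (hG : Function.Injective (evalColumns G)) :
    Function.Injective fun V : Submodule F (Fin k → F) =>
      V.dualAnnihilator.map (evalColumns G) := by
  intro V W h
  have h' := Submodule.map_injective_of_injective hG h
  rw [← Subspace.dualAnnihilator_dualCoannihilator_eq (W := V), h',
    Subspace.dualAnnihilator_dualCoannihilator_eq]

theorem exists_subcode_iff {G : Matrix (Fin k) (Fin n) F}
    (hG : Function.Injective (evalColumns G)) {j : ℕ} (hj : j ≤ k)
    (D : Submodule F (Fin n → F)) :
    D ≤ rowCode G ∧ finrank F D = j ↔ ∃ V : Submodule F (Fin k → F),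
      finrank F V = k - j ∧ V.dualAnnihilator.map (evalColumns G) = D := by
  have hd : ∀ V : Submodule F (Fin k → F),
      finrank F V + finrank F (V.dualAnnihilator.map (evalColumns G)) = k := by
    intro V
    rw [LinearEquiv.finrank_eq (Submodule.equivMapOfInjective _ hG V.dualAnnihilator).symm,
      Subspace.finrank_add_finrank_dualAnnihilator_eq, finrank_fin_fun]
  rw [← range_evalColumns]
  constructor
  · rintro ⟨hD, rfl⟩
    have h : (D.comap (evalColumns G)).dualCoannihilator.dualAnnihilator.map (evalColumns G) =
        D := by
      rw [Subspace.dualCoannihilator_dualAnnihilator_eq, Submodule.map_comap_eq, inf_eq_right.2 hD]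
    refine ⟨_, ?_, h⟩
    have := hd (D.comap (evalColumns G)).dualCoannihilator
    rw [h] at this
    omega
  · rintro ⟨V, hV, rfl⟩
    have := hd V
    exact ⟨LinearMap.map_le_range, by omega⟩

theorem supportWeightDistr_rowCode {G : Matrix (Fin k) (Fin n) F}
    (hG : Function.Injective (evalColumns G)) {j : ℕ} (hj : j ≤ k) (i : ℕ) :
    supportWeightDistr (rowCode G) j i = {V : Submodule F (Fin k → F) | finrank F V = k - j ∧
      supportWeight (V.dualAnnihilator.map (evalColumns G)) = i}.ncard := by
  rw [← Set.ncard_image_of_injective _ (map_evalColumns_dualAnnihilator_injective hG),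
    supportWeightDistr]
  congr 1
  ext D
  rw [Set.mem_ofPred_eq, ← and_assoc, exists_subcode_iff hG hj]
  constructor
  · rintro ⟨⟨V, hV, rfl⟩, hi⟩
    exact ⟨V, ⟨hV, hi⟩, rfl⟩
  · rintro ⟨V, ⟨hV, hi⟩, rfl⟩
    exact ⟨⟨V, hV, rfl⟩, hi⟩

theorem minSupportWeight_rowCode {G : Matrix (Fin k) (Fin n) F}
    (hG : Function.Injective (evalColumns G)) {j : ℕ} (hj : j ≤ k) :
    minSupportWeight (rowCode G) j = sInf {w | ∃ V : Submodule F (Fin k → F),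
      finrank F V = k - j ∧ supportWeight (V.dualAnnihilator.map (evalColumns G)) = w} := by
  rw [minSupportWeight]
  congr 1
  ext w
  constructor
  · rintro ⟨D, hD, hj', rfl⟩
    obtain ⟨V, hV, rfl⟩ := (exists_subcode_iff hG hj D).1 ⟨hD, hj'⟩
    exact ⟨V, hV, rfl⟩
  · rintro ⟨V, hV, rfl⟩
    obtain ⟨hD, hj'⟩ := (exists_subcode_iff hG hj _).2 ⟨V, hV, rfl⟩
    exact ⟨_, hD, hj', rfl⟩

end Encoding

theorem add_finrank_le {F : Type*} [Field F] {k : ℕ} {S₁ S₂ : Submodule F (Fin k → F)}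
    (hS : S₁ ⊓ S₂ = ⊥) :
    finrank F S₁ + finrank F S₂ ≤ k := by
  have h := Submodule.finrank_sup_add_finrank_inf_eq S₁ S₂
  have := Submodule.finrank_le (S₁ ⊔ S₂)
  rw [finrank_fin_fun] at this
  rw [hS, finrank_bot] at h
  omega

/-! ### The code whose columns avoid S₁ ∪ S₂. -/

section Anticode

variable {F : Type*} [Field F] [Fintype F] {k n : ℕ} {G : Matrix (Fin k) (Fin n) F}
  {S₁ S₂ : Submodule F (Fin k → F)}

theorem supportWeight_eq (hS : S₁ ⊓ S₂ = ⊥)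
    (hG : IsMatrixOfSet G {x : Fin k → F | ¬ (x ∈ S₁ ∨ x ∈ S₂)}) (V : Submodule F (Fin k → F)) :
    (n : ℤ) - supportWeight (V.dualAnnihilator.map (evalColumns G)) =
      (Fintype.card F : ℤ) ^ finrank F V -
        (Fintype.card F : ℤ) ^ finrank F (V.comap S₁.subtype) -
        (Fintype.card F : ℤ) ^ finrank F (V.comap S₂.subtype) + 1 := by
  rw [← ncard_mem_sdiff S₁ S₂ hS]
  have h := supportWeight_add_ncard G V
  have h' := ncard_column_mem hG V
  simp only [Set.mem_ofPred_eq] at h'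
  omega

theorem length_eq (hS : S₁ ⊓ S₂ = ⊥)
    (hG : IsMatrixOfSet G {x : Fin k → F | ¬ (x ∈ S₁ ∨ x ∈ S₂)}) :
    (n : ℤ) = (Fintype.card F : ℤ) ^ k - (Fintype.card F : ℤ) ^ finrank F S₁ -
      (Fintype.card F : ℤ) ^ finrank F S₂ + 1 := by
  have h := supportWeight_add_ncard G ⊤
  have h' := supportWeight_eq hS hG ⊤
  have h₀ : {c : Fin n | (fun r => G r c) ∈ (⊤ : Submodule F (Fin k → F))} = Set.univ :=
    Set.eq_univ_of_forall fun _ => trivial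
  rw [h₀, Set.ncard_univ, Nat.card_eq_fintype_card, Fintype.card_fin] at h
  have e : ∀ S : Submodule F (Fin k → F),
      finrank F ((⊤ : Submodule F (Fin k → F)).comap S.subtype) = finrank F S :=
    fun S => by rw [Submodule.comap_top, finrank_top]
  rw [e, e, finrank_top, finrank_fin_fun] at h'
  omega

/-- The kernel of a nonzero functional vanishing at all columns would be a hyperplane containing
them all, against the inequality of counts. -/
theorem evalColumns_injective (hS : S₁ ⊓ S₂ = ⊥)
    (hG : IsMatrixOfSet G {x : Fin k → F | ¬ (x ∈ S₁ ∨ x ∈ S₂)})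
    (h₁ : finrank F S₁ < k) (h₂ : finrank F S₂ < k)
    (hexc : ¬ (Fintype.card F = 2 ∧ k = 2 ∧ finrank F S₁ = 1 ∧ finrank F S₂ = 1)) :
    Function.Injective (evalColumns G) := by
  rw [← LinearMap.ker_eq_bot, LinearMap.ker_eq_bot']
  intro f hf
  by_contra hf0
  have hker := Dual.finrank_ker_add_one_of_ne_zero hf0
  rw [finrank_fin_fun] at hker
  have hw := supportWeight_add_ncard G f.ker
  have h₀ : {c : Fin n | (fun r => G r c) ∈ f.ker} = Set.univ :=
    Set.eq_univ_of_forall fun c => congrFun hf c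
  rw [h₀, Set.ncard_univ, Nat.card_eq_fintype_card, Fintype.card_fin] at hw
  have h := supportWeight_eq hS hG f.ker
  have hn := length_eq hS hG
  have l₁ := le_finrank_comap_subtype f.ker S₁
  have l₂ := le_finrank_comap_subtype f.ker S₂
  rw [finrank_fin_fun] at l₁ l₂
  have hq : (2 : ℤ) ≤ Fintype.card F := by exact_mod_cast Fintype.one_lt_card (α := F)
  have hexc' : ¬ ((Fintype.card F : ℤ) = 2 ∧ k = 2 ∧ finrank F S₁ = 1 ∧ finrank F S₂ = 1) := by
    exact_mod_cast hexc
  refine pow_sub_pow_sub_pow_ne hq h₁ h₂ (add_finrank_le hS) hexc'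
    (Submodule.finrank_le (f.ker.comap S₁.subtype))
    (Submodule.finrank_le (f.ker.comap S₂.subtype)) (by omega) (by omega) ?_
  rw [(by omega : finrank F f.ker = k - 1)] at h
  omega

theorem supportWeightDistr_eq (hS : S₁ ⊓ S₂ = ⊥)
    (hG : IsMatrixOfSet G {x : Fin k → F | ¬ (x ∈ S₁ ∨ x ∈ S₂)})
    (hi : Function.Injective (evalColumns G)) {j i t₁ t₂ : ℕ} (hj : j ≤ k)
    (h : (n : ℤ) - i = (Fintype.card F : ℤ) ^ (k - j) - (Fintype.card F : ℤ) ^ t₁ -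
      (Fintype.card F : ℤ) ^ t₂ + 1) :
    (supportWeightDistr (rowCode G) j i : ℚ) =
      if t₁ = t₂ then
        outerCount (Fintype.card F) k (k - j) (finrank F S₁) (finrank F S₂) t₁ t₂
      else outerCount (Fintype.card F) k (k - j) (finrank F S₁) (finrank F S₂) t₁ t₂ +
        outerCount (Fintype.card F) k (k - j) (finrank F S₁) (finrank F S₂) t₂ t₁ := by
  set P : ℕ → ℕ → Set (Submodule F (Fin k → F)) := fun a b => {V | finrank F V = k - j ∧
    finrank F (V.comap S₁.subtype) = a ∧ finrank F (V.comap S₂.subtype) = b} with hP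
  have hcard : ∀ a b, ((P a b).ncard : ℚ) =
      outerCount (Fintype.card F) k (k - j) (finrank F S₁) (finrank F S₂) a b := by
    intro a b
    have := natCard_finrank_comap_subtype S₁ S₂ hS (k - j) a b
    rwa [finrank_fin_fun] at this
  have hset : {V : Submodule F (Fin k → F) | finrank F V = k - j ∧
      supportWeight (V.dualAnnihilator.map (evalColumns G)) = i} = P t₁ t₂ ∪ P t₂ t₁ := by
    ext V
    rw [hP, Set.mem_union, Set.mem_ofPred_eq, Set.mem_ofPred_eq, Set.mem_ofPred_eq, ← and_or_left]
    refine and_congr_right fun hV => ?_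
    rw [← pow_add_pow_eq_iff (Fintype.one_lt_card (α := F))]
    have hw := supportWeight_eq hS hG V
    rw [hV] at hw
    zify
    constructor <;> intro <;> linarith
  rw [supportWeightDistr_rowCode hi hj, hset]
  split_ifs with ht
  · rw [ht, Set.union_self, hcard]
  -- The two orders of t₁ ≠ t₂ give disjoint families; an order out of range contributes 0.
  · rw [Set.ncard_union_eq _ (Set.toFinite _) (Set.toFinite _), Nat.cast_add, hcard, hcard]
    rw [Set.disjoint_left]
    rintro V ⟨-, rfl, rfl⟩ ⟨-, h, -⟩
    exact ht h

theorem supportWeightDistr_eq_zero (hS : S₁ ⊓ S₂ = ⊥)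
    (hG : IsMatrixOfSet G {x : Fin k → F | ¬ (x ∈ S₁ ∨ x ∈ S₂)})
    (hi : Function.Injective (evalColumns G)) {j i : ℕ} (hj : j ≤ k)
    (h : ¬ ∃ t₁ t₂ : ℕ, max 0 ((finrank F S₁ : ℤ) - j) ≤ t₁ ∧ t₁ ≤ finrank F S₁ ∧
      max 0 ((finrank F S₂ : ℤ) - j) ≤ t₂ ∧ t₂ ≤ finrank F S₂ ∧
      (n : ℤ) - i = (Fintype.card F : ℤ) ^ (k - j) - (Fintype.card F : ℤ) ^ t₁ -
        (Fintype.card F : ℤ) ^ t₂ + 1) :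
    supportWeightDistr (rowCode G) j i = 0 := by
  rw [supportWeightDistr_rowCode hi hj, Set.ncard_eq_zero (Set.toFinite _),
    Set.eq_empty_iff_forall_notMem]
  rintro V ⟨hV, rfl⟩
  have l₁ := le_finrank_comap_subtype V S₁
  have l₂ := le_finrank_comap_subtype V S₂
  rw [finrank_fin_fun] at l₁ l₂
  have hw := supportWeight_eq hS hG V
  rw [hV] at hw
  exact h ⟨_, _, by omega, Submodule.finrank_le (V.comap S₁.subtype), by omega,
    Submodule.finrank_le (V.comap S₂.subtype), hw⟩

theorem exists_minimal_finrank_comap (hS : S₁ ⊓ S₂ = ⊥) {j : ℕ} (hj : j ≤ k) :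
    ∃ V : Submodule F (Fin k → F), finrank F V = k - j ∧
      finrank F (V.comap S₁.subtype) = finrank F S₁ - j ∧
      finrank F (V.comap S₂.subtype) = finrank F S₂ - j := by
  have hu := add_finrank_le hS
  have hpos : 0 < outerCount (Fintype.card F) k (k - j) (finrank F S₁) (finrank F S₂)
      (finrank F S₁ - j) (finrank F S₂ - j) :=
    -- The least admissible t: V ∩ (S₁ ⊕ S₂) has dimension at least u₁ + u₂ - j, and u_r - t_r =
    -- min(u_r, j).
    outerCount_pos Fintype.one_lt_card (min (finrank F S₁) j + min (finrank F S₂) j - j)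
      (by omega) (by omega) (by omega) (by omega) hu
  have hc := natCard_finrank_comap_subtype S₁ S₂ hS (k - j) (finrank F S₁ - j) (finrank F S₂ - j)
  rw [finrank_fin_fun] at hc
  rw [← hc, Nat.cast_pos, Nat.card_pos_iff] at hpos
  obtain ⟨⟨V, hV⟩, -⟩ := hpos
  exact ⟨V, hV⟩

theorem minSupportWeight_eq (hS : S₁ ⊓ S₂ = ⊥)
    (hG : IsMatrixOfSet G {x : Fin k → F | ¬ (x ∈ S₁ ∨ x ∈ S₂)})
    (hi : Function.Injective (evalColumns G)) {j : ℕ} (hj : j ≤ k) :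
    (minSupportWeight (rowCode G) j : ℤ) = n - (Fintype.card F : ℤ) ^ (k - j) +
      (Fintype.card F : ℤ) ^ (finrank F S₁ - j) + (Fintype.card F : ℤ) ^ (finrank F S₂ - j) -
      1 := by
  obtain ⟨V, hV, hV₁, hV₂⟩ := exists_minimal_finrank_comap hS hj
  have hw := supportWeight_eq hS hG V
  rw [hV, hV₁, hV₂] at hw
  suffices h : minSupportWeight (rowCode G) j =
      supportWeight (V.dualAnnihilator.map (evalColumns G)) by
    rw [h]
    linarith
  rw [minSupportWeight_rowCode hi hj]
  refine le_antisymm (Nat.sInf_le ⟨V, hV, rfl⟩) (le_csInf ⟨_, V, hV, rfl⟩ ?_)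
  rintro _ ⟨W, hW, rfl⟩
  have l₁ := le_finrank_comap_subtype W S₁
  have l₂ := le_finrank_comap_subtype W S₂
  rw [finrank_fin_fun] at l₁ l₂
  have hw' := supportWeight_eq hS hG W
  rw [hW] at hw'
  -- The weight increases with each t_r, and t_r ≥ u_r - j because V has codimension j.
  have hq : (1 : ℤ) ≤ Fintype.card F := by exact_mod_cast Fintype.card_pos (α := F)
  have m₁ := pow_le_pow_right₀ hq
    (by omega : finrank F S₁ - j ≤ finrank F (W.comap S₁.subtype))
  have m₂ := pow_le_pow_right₀ hq
    (by omega : finrank F S₂ - j ≤ finrank F (W.comap S₂.subtype))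
  zify
  linarith

end Anticode
end SolomonStiffler

theorem mainTheorem4 {F : Type*} [Field F] [Fintype F] (q : ℕ) (hq : Fintype.card F = q)
    (k u₁ u₂ : ℕ) (hu₁ : u₁ < k) (hu₂ : u₂ < k)
    (hexc : ¬ (q = 2 ∧ k = 2 ∧ u₁ = 1 ∧ u₂ = 1))
    (S₁ S₂ : Submodule F (Fin k → F))
    (hS₁ : Module.finrank F S₁ = u₁) (hS₂ : Module.finrank F S₂ = u₂)
    (hS : S₁ ⊓ S₂ = ⊥)
    (n : ℕ) (G : Matrix (Fin k) (Fin n) F)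
    (hG : SolomonStiffler.IsMatrixOfSet G {x : Fin k → F | ¬ (x ∈ S₁ ∨ x ∈ S₂)})
    (C : Submodule F (Fin n → F)) (hC : C = SolomonStiffler.rowCode G) :
    -- `C` is a code of length `q^k - q^u₁ - q^u₂ + 1` and dimension `k`
    (n : ℤ) = (q : ℤ) ^ k - (q : ℤ) ^ u₁ - (q : ℤ) ^ u₂ + 1 ∧
    Module.finrank F C = k ∧
    -- the `j`-th support weight distribution
    (∀ j : ℕ, 1 ≤ j → j ≤ k → ∀ i : ℕ, i ≤ n →
      (∀ t₁ t₂ : ℕ, max 0 ((u₁ : ℤ) - j) ≤ t₁ → t₁ ≤ u₁ → max 0 ((u₂ : ℤ) - j) ≤ t₂ → t₂ ≤ u₂ →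
        (n : ℤ) - i = (q : ℤ) ^ (k - j) - (q : ℤ) ^ t₁ - (q : ℤ) ^ t₂ + 1 →
        (SolomonStiffler.supportWeightDistr C j i : ℚ) =
          if t₁ = t₂ then SolomonStiffler.outerCount q k (k - j) u₁ u₂ t₁ t₂
          else SolomonStiffler.outerCount q k (k - j) u₁ u₂ t₁ t₂ +
            SolomonStiffler.outerCount q k (k - j) u₁ u₂ t₂ t₁) ∧
      ((¬ ∃ t₁ t₂ : ℕ, max 0 ((u₁ : ℤ) - j) ≤ t₁ ∧ t₁ ≤ u₁ ∧ max 0 ((u₂ : ℤ) - j) ≤ t₂ ∧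
          t₂ ≤ u₂ ∧ (n : ℤ) - i = (q : ℤ) ^ (k - j) - (q : ℤ) ^ t₁ - (q : ℤ) ^ t₂ + 1) →
        SolomonStiffler.supportWeightDistr C j i = 0)) ∧
    -- the weight hierarchy
    SolomonStiffler.weightHierarchy C = SolomonStiffler.minSupportWeight C '' Set.Icc 1 k ∧
    (∀ j : ℕ, 1 ≤ j → j ≤ k →
      (SolomonStiffler.minSupportWeight C j : ℤ) =
        (q : ℤ) ^ k - (q : ℤ) ^ u₁ - (q : ℤ) ^ u₂ - (q : ℤ) ^ (k - j) +
          (if j < u₁ then (q : ℤ) ^ (u₁ - j) else 1) +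
          (if j < u₂ then (q : ℤ) ^ (u₂ - j) else 1)) := by
  subst hq hS₁ hS₂ hC
  have hi := SolomonStiffler.evalColumns_injective hS hG hu₁ hu₂ hexc
  have hn := SolomonStiffler.length_eq hS hG
  have hk : Module.finrank F (SolomonStiffler.rowCode G) = k := by
    rw [← SolomonStiffler.range_evalColumns, LinearMap.finrank_range_of_inj hi,
      Subspace.dual_finrank_eq, Module.finrank_fin_fun]
  refine ⟨hn, hk, fun j _ hj i _ => ⟨fun t₁ t₂ _ _ _ _ h => ?_, fun h => ?_⟩, ?_, fun j _ hj => ?_⟩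
  · exact SolomonStiffler.supportWeightDistr_eq hS hG hi hj h
  · exact SolomonStiffler.supportWeightDistr_eq_zero hS hG hi hj h
  · rw [SolomonStiffler.weightHierarchy, hk]
    ext w
    simp only [Set.mem_ofPred_eq, Set.mem_image, Set.mem_Icc, and_assoc]
  · have key : ∀ u : ℕ, (if j < u then (Fintype.card F : ℤ) ^ (u - j) else 1) =
        (Fintype.card F : ℤ) ^ (u - j) := by
      intro u
      split_ifs with h
      · rfl
      · rw [Nat.sub_eq_zero_of_le (not_lt.1 h), pow_zero]
    rw [SolomonStiffler.minSupportWeight_eq hS hG hi hj, hn, key, key]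
    ring
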